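/- **Theorem 2.4.** Let $A$ be a complex Banach algebra with identity $\mathbf 1$ and let $a,b\in A$. Put $C_{a,b}x=ax-xb$ for $x\in A$ and $$\varrho(a,b)=\limsup_{n\to\infty}\bigl\|C_{a,b}^n\mathbf 1\bigr\|^{1/n}.$$ Let $\sigma(\cdot)$ denote the spectrum and $\sigma'(\cdot)=\sigma(\cdot)\setminus\{0\}$ the set of nonzero spectral values. For $x\in A$ and $\alpha\in\mathbb C$ not an accumulation point of $\sigma(x)$, let $$p(\alpha,x)=\frac1{2\pi i}\int_{\Gamma_\alpha}(\lambda\mathbf 1-x)^{-1}\,d\lambda$$ be the Riesz projection of $x$ at $\alpha$, where $\Gamma_\alpha$ is a small positively oriented circle with centre $\alpha$, disjoint from $\sigma(x)$, isolating $\alpha$ from the rest of $\sigma(x)$. Suppose that $\sigma'(a)$ and $\sigma'(b)$ are discrete sets which have no accumulation point in $\mathbb C$ other than, possibly, $0$. Then at least one of the following holds: 1. $\varrho(a,b)=\sup\{|\lambda-\beta| : \lambda\in\sigma'(a),\ \beta\in\sigma'(b),\ p(\lambda,a)\,p(\beta,b)\neq0\}$, where $\sup\emptyset=0$; 2. $\varrho(a,b)=|\lambda|$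 for some $\lambda\in\sigma'(a)$; 3. $\varrho(a,b)=|\beta|$ for some $\beta\in\sigma'(b)$. Moreover, $\varrho(a,b)=0$ if and only if $\sigma(a)=\sigma(b)$ and $p(\lambda,a)=p(\lambda,b)$ for every nonzero $\lambda$ in this common spectrum. -/

import Mathlib

open scoped Topology

namespace RieszSpectral

noncomputable section

variable {A : Type*} [NormedRing A] [NormedAlgebra ℂ A]

/-- The operator `C_{a,b} = L_a - R_b` on `A`, that is `x ↦ a x - x b`. -/
def commutatorOp (a b : A) : Module.End ℂ A :=
  LinearMap.mulLeft ℂ a - LinearMap.mulRight ℂ b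

/-- `ϱ(a,b) = limsup_n ‖C_{a,b}^n 1‖^{1/n}`. The sequence is bounded
(eventually by any number above `‖a‖ + ‖b‖`), so this is the genuine limsup. -/
def varrho (a b : A) : ℝ :=
  Filter.limsup (fun n : ℕ => ‖((commutatorOp a b) ^ n) 1‖ ^ (1 / (n : ℝ))) Filter.atTop

/-- The nonzero spectrum `σ'(a) = σ(a) \ {0}`. -/
def nonzeroSpectrum (a : A) : Set ℂ := spectrum ℂ a \ {0}

/-- Every accumulation point of `S` in `ℂ` is `0`. For a set `S` which does not contain `0`
this says that `S` is discrete and clusters at `0`, if anywhere. -/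
def ClustersOnlyAtZero (S : Set ℂ) : Prop :=
  ∀ z : ℂ, AccPt z (Filter.principal S) → z = 0

/-- The circle with centre `α` and radius `r` isolates `α` from the remaining spectrum of `a`:
the closed disc contains no spectral value except possibly `α` itself. In particular the circle
is disjoint from the spectrum. -/
def IsIsolatingRadius (a : A) (α : ℂ) (r : ℝ) : Prop :=
  0 < r ∧ Metric.closedBall α r ∩ spectrum ℂ a ⊆ {α}

open Classical in
/-- The Riesz projection `p(α,a) = (2πi)⁻¹ ∮ (λ 1 - a)⁻¹ dλ` over an isolating circle around `α`;
it does not depend on the circle, see `rieszProjection_eq`. If `α` is an accumulation point of the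
spectrum, there is no isolating circle and the value is set to `0`. -/
def rieszProjection (a : A) (α : ℂ) : A :=
  if h : ∃ r : ℝ, IsIsolatingRadius a α r then
    (2 * Real.pi * Complex.I : ℂ)⁻¹ • ∮ z in C(α, h.choose), resolvent a z
  else 0

theorem circleIntegral_resolvent_eq [CompleteSpace A] {a : A} {α : ℂ} {r s : ℝ}
    (hr : 0 < r) (hrs : r ≤ s) (hs : IsIsolatingRadius a α s) :
    (∮ z in C(α, s), resolvent a z) = ∮ z in C(α, r), resolvent a z := by
  have key : ∀ z ∈ Metric.closedBall α s \ Metric.ball α r,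
      DifferentiableAt ℂ (resolvent a) z := by
    intro z hz
    have hz' : z ∈ resolventSet ℂ a := by
      by_contra hmem
      have : z = α := hs.2 ⟨hz.1, hmem⟩
      exact hz.2 (by rw [this]; exact Metric.mem_ball_self hr)
    exact (spectrum.hasDerivAt_resolvent_const_left hz').differentiableAt
  refine Complex.circleIntegral_eq_of_differentiable_on_annulus_off_countable hr hrs
    Set.countable_empty (fun z hz => (key z hz).continuousAt.continuousWithinAt) ?_
  intro z hz
  refine key z ⟨Metric.ball_subset_closedBall hz.1.1, fun h => hz.1.2 ?_⟩
  exact Metric.ball_subset_closedBall h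

/-- The Riesz projection may be computed with any isolating circle. -/
theorem rieszProjection_eq [CompleteSpace A] {a : A} {α : ℂ} {r : ℝ}
    (hr : IsIsolatingRadius a α r) :
    rieszProjection a α = (2 * Real.pi * Complex.I : ℂ)⁻¹ • ∮ z in C(α, r), resolvent a z := by
  have h : ∃ r : ℝ, IsIsolatingRadius a α r := ⟨r, hr⟩
  rw [rieszProjection, dif_pos h]
  rcases le_total r h.choose with hle | hle
  · rw [circleIntegral_resolvent_eq hr.1 hle h.choose_spec]
  · rw [circleIntegral_resolvent_eq h.choose_spec.1 hle hr]

/-- The set `W = {|λ - β| : λ ∈ σ'(a), β ∈ σ'(b), p(λ,a) p(β,b) ≠ 0}`. It is a bounded set of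
nonnegative numbers. -/
def distanceSet (a b : A) : Set ℝ :=
  {d | ∃ l ∈ nonzeroSpectrum a, ∃ m ∈ nonzeroSpectrum b,
    rieszProjection a l * rieszProjection b m ≠ 0 ∧ d = ‖l - m‖}

end

end RieszSpectral

/-!
# The growth of `C_{a,b}ⁿ 1` and the Riesz projections of `a` and `b`

Write `p` for a Riesz projection of `a` at `λ` and `q` for one of `b` at `β`. The whole argument
compares growth rates. Left multiplication by `a - λ`, right multiplication by `b - β` and `C_{a,b}`
commute, and `C_{a,b}` differs from the scalar `λ - β` by the first two, which are quasinilpotent at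
`p q`. The binomial expansion (`norm_add_add_pow_apply_le`) therefore shows that `C_{a,b}ⁿ (p q)`
grows at the exact rate `|λ - β|` when `p q ≠ 0`; as `C_{a,b}ⁿ (p q) = p (C_{a,b}ⁿ 1) q`, that rate is
at most `ϱ(a,b)`. These two bounds, `IsSpectralPiece.growsBelow` and `IsSpectralPiece.norm_sub_le`,
are stated for elements `p`, `q` on which `a - λ`, `b - β` have small spectral radius, not
necessarily zero.

For `ε > 0` the identity is a finite sum of Riesz projections at the spectral values of modulus at
least `ε` and a remainder on which the spectral radius is at most `ε`
(`ClustersOnlyAtZero.exists_decomposition`). Multiply such decompositions for `a` and for `b`. If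
`ϱ(a,b) > 0` is not the modulus of a spectral value, the lower bound and the gap around `ϱ(a,b)` keep
the rates of the nonzero terms that involve a remainder strictly below `ϱ(a,b)`. Since the terms add
up to `1`, some term `p q ≠ 0` must have rate exactly `ϱ(a,b)`, which is thus the greatest element of
the distance set (`varrho_mem_distanceSet`).

If spectra and projections agree, the decompositions agree, and only the terms with `λ = β` and the
product of the remainders survive, so that `ϱ(a,b)` is arbitrarily small. Conversely, if
`ϱ(a,b) = 0`, right multiplication by `b - λ` is quasinilpotent at `p`, while `b - λ` is invertible
on the range of `1 - q` for the Riesz projection `q` of `b` at the same point; hence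
`p (1 - q) = 0`, similarly `(1 - p) q = 0`, and `p = q`. A Riesz projection vanishes exactly off the
spectrum, so the nonzero spectra agree, and so do the spectra at `0`: either `0` is an accumulation
point of both, or the same argument applies to it.

The Riesz projections are handled through the moments of the resolvent on a small circle, whose
recursion `IsIsolatingRadius.sub_mul_resolventMoment` yields idempotence, quasinilpotence of `a - λ`
on the range and invertibility off it.
-/

namespace RieszSpectral

open Filter

variable {A : Type*} [NormedRing A] [NormedAlgebra ℂ A]

/-! ### Geometric bounds and `n`-th roots -/

theorem exists_le_mul_pow_of_eventually {u : ℕ → ℝ} {r : ℝ} (hr : 0 < r)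
    (h : ∀ᶠ n in atTop, u n ≤ r ^ n) : ∃ K, ∀ n, u n ≤ K * r ^ n := by
  obtain ⟨N, hN⟩ := eventually_atTop.1 h
  refine ⟨1 + ∑ i ∈ Finset.range N, |u i| / r ^ i, fun n => ?_⟩
  have hpos : ∀ i, 0 ≤ |u i| / r ^ i := fun i => by positivity
  rcases lt_or_ge n N with hn | hn
  · have h1 : |u n| / r ^ n ≤ ∑ i ∈ Finset.range N, |u i| / r ^ i :=
      Finset.single_le_sum (fun i _ => hpos i) (Finset.mem_range.2 hn)
    have h2 : |u n| = |u n| / r ^ n * r ^ n := by field_simp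
    calc u n ≤ |u n| := le_abs_self _
      _ = |u n| / r ^ n * r ^ n := h2
      _ ≤ _ := by gcongr; linarith
  · calc u n ≤ 1 * r ^ n := by simpa using hN n hn
      _ ≤ _ := by
        gcongr
        have := Finset.sum_nonneg (fun i (_ : i ∈ Finset.range N) => hpos i)
        linarith

theorem le_pow_of_rpow_one_div_le {x r : ℝ} (hx : 0 ≤ x) {n : ℕ} (hn : n ≠ 0)
    (h : x ^ (1 / (n : ℝ)) ≤ r) : x ≤ r ^ n := by
  calc x = (x ^ (1 / (n : ℝ))) ^ n := by
        rw [one_div, Real.rpow_inv_natCast_pow hx hn]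
    _ ≤ r ^ n := by gcongr

theorem rpow_one_div_le_of_le_mul_pow {x K r : ℝ} (hx : 0 ≤ x) (hK : 0 ≤ K) (hr : 0 ≤ r) {n : ℕ}
    (hn : n ≠ 0) (h : x ≤ K * r ^ n) : x ^ (1 / (n : ℝ)) ≤ K ^ (1 / (n : ℝ)) * r := by
  calc x ^ (1 / (n : ℝ)) ≤ (K * r ^ n) ^ (1 / (n : ℝ)) := by gcongr
    _ = K ^ (1 / (n : ℝ)) * r := by
      rw [Real.mul_rpow hK (by positivity), one_div, Real.pow_rpow_inv_natCast hr hn]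

theorem tendsto_rpow_one_div_mul {K : ℝ} (hK : 0 < K) (r : ℝ) :
    Tendsto (fun n : ℕ => K ^ (1 / (n : ℝ)) * r) atTop (𝓝 r) := by
  have h1 : Tendsto (fun n : ℕ => K ^ (1 / (n : ℝ))) atTop (𝓝 (K ^ (0 : ℝ))) :=
    (Real.continuousAt_const_rpow hK.ne').tendsto.comp tendsto_one_div_atTop_nhds_zero_nat
  simpa using h1.mul_const r

/-- A nonzero quantity cannot decay faster than it grows: the form in which growth rates are
compared. -/
theorem le_of_pow_mul_le {x c s K : ℝ} (hx : 0 < x) (hs : 0 ≤ s)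
    (h : ∀ n : ℕ, c ^ n * x ≤ K * s ^ n) : c ≤ s := by
  by_contra! hlt
  rcases hs.eq_or_lt with rfl | hs
  · have h1 := h 1
    simp only [pow_one, mul_zero] at h1
    nlinarith [mul_pos hlt hx]
  · have h1 : Tendsto (fun n : ℕ => (c / s) ^ n) atTop atTop :=
      tendsto_pow_atTop_atTop_of_one_lt ((one_lt_div hs).2 hlt)
    obtain ⟨n, hn⟩ := (h1.eventually_gt_atTop (K / x)).exists
    rw [div_pow, div_lt_div_iff₀ hx (by positivity)] at hn
    linarith [h n]

theorem eq_zero_of_forall_norm_le {E : Type*} [NormedAddCommGroup E] {x : E} {K s : ℝ} (hs : 0 ≤ s) (hs1 : s < 1)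
    (h : ∀ n : ℕ, ‖x‖ ≤ K * s ^ n) : x = 0 := by
  by_contra hx
  have := le_of_pow_mul_le (c := 1) (norm_pos_iff.2 hx) hs (fun n => by simpa using h n)
  linarith

theorem exists_pos_mul_lt_one {x : ℝ} (hx : 0 ≤ x) : ∃ r : ℝ, 0 < r ∧ r * x < 1 :=
  ⟨1 / (x + 1), by positivity, by
    rw [one_div_mul_eq_div, div_lt_one (by positivity)]
    exact lt_add_one _⟩

/-- If `p dⁿ` decays superexponentially, `p` annihilates every idempotent on which `d` is
invertible. -/
theorem mul_eq_zero_of_norm_mul_pow_le {R : Type*} [NormedRing R] {p d c e : R}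
    (he : IsIdempotentElem e) (hdc : d * c = e) (hcomm : Commute d c)
    (h : ∀ r : ℝ, 0 < r → ∃ K, ∀ n : ℕ, ‖p * d ^ n‖ ≤ K * r ^ n) :
    p * e = 0 := by
  obtain ⟨r, hr, hrc⟩ := exists_pos_mul_lt_one (norm_nonneg c)
  obtain ⟨K, hK⟩ := h r hr
  refine eq_zero_of_forall_norm_le (K := K * (r * ‖c‖)) (s := r * ‖c‖) (by positivity) hrc
    fun n => ?_
  rw [← he.pow_succ_eq n, ← hdc, hcomm.mul_pow, ← mul_assoc]
  calc _ ≤ _ := norm_mul_le _ _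
    _ ≤ (K * r ^ (n + 1)) * ‖c‖ ^ (n + 1) := by
      have := (norm_nonneg _).trans (hK (n + 1))
      gcongr
      exacts [hK _, norm_pow_le' c n.succ_pos]
    _ = _ := by ring

theorem mul_eq_zero_of_norm_pow_mul_le {R : Type*} [NormedRing R] {q d c e : R}
    (he : IsIdempotentElem e) (hdc : d * c = e) (hcomm : Commute d c)
    (h : ∀ r : ℝ, 0 < r → ∃ K, ∀ n : ℕ, ‖d ^ n * q‖ ≤ K * r ^ n) :
    e * q = 0 := by
  obtain ⟨r, hr, hrc⟩ := exists_pos_mul_lt_one (norm_nonneg c)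
  obtain ⟨K, hK⟩ := h r hr
  refine eq_zero_of_forall_norm_le (K := K * (r * ‖c‖)) (s := r * ‖c‖) (by positivity) hrc
    fun n => ?_
  rw [← he.pow_succ_eq n, ← hdc, hcomm.eq, hcomm.symm.mul_pow, mul_assoc]
  calc _ ≤ _ := norm_mul_le _ _
    _ ≤ ‖c‖ ^ (n + 1) * (K * r ^ (n + 1)) := by
      gcongr
      exacts [norm_pow_le' c n.succ_pos, hK _]
    _ = _ := by ring

/-- Gelfand's formula as a geometric bound. -/
theorem exists_norm_pow_le [CompleteSpace A] {x : A} {s r : ℝ} (hs : 0 ≤ s) (hsr : s < r)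
    (h : ∀ z ∈ spectrum ℂ x, ‖z‖ ≤ s) : ∃ K, ∀ n : ℕ, ‖x ^ n‖ ≤ K * r ^ n := by
  have hr : 0 < r := hs.trans_lt hsr
  refine exists_le_mul_pow_of_eventually hr ?_
  have h1 : spectralRadius ℂ x < ENNReal.ofReal r := by
    refine lt_of_le_of_lt (iSup₂_le fun z hz => ?_) ((ENNReal.ofReal_lt_ofReal_iff hr).2 hsr)
    rw [← ENNReal.ofReal_coe_nnreal, coe_nnnorm]
    exact ENNReal.ofReal_le_ofReal (h z hz)
  filter_upwards [(spectrum.pow_norm_pow_one_div_tendsto_nhds_spectralRadius x).eventually_lt_const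
    h1, eventually_ne_atTop 0] with n hn hn0
  exact le_pow_of_rpow_one_div_le (norm_nonneg _) hn0 ((ENNReal.ofReal_lt_ofReal_iff hr).1 hn).le

/-! ### Riesz projections -/

/-- The contour moment `(2πi)⁻¹ ∮ (z - α)ⁿ (z 1 - a)⁻¹ dz` over the circle of radius `r` around
`α`; up to reindexing, the Laurent coefficients of the resolvent at `α`. -/
noncomputable def resolventMoment (a : A) (α : ℂ) (r : ℝ) (n : ℤ) : A :=
  (2 * Real.pi * Complex.I : ℂ)⁻¹ • ∮ z in C(α, r), (z - α) ^ n • resolvent a z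

namespace IsIsolatingRadius

variable {a : A} {α : ℂ} {r : ℝ}

theorem mem_resolventSet (hr : IsIsolatingRadius a α r) {z : ℂ} (hz : z ∈ Metric.sphere α r) :
    z ∈ resolventSet ℂ a := by
  by_contra hmem
  have : z = α := hr.2 ⟨Metric.sphere_subset_closedBall hz, hmem⟩
  subst this
  have := hr.1
  simp_all

theorem sub_ne_zero (hr : IsIsolatingRadius a α r) {z : ℂ} (hz : z ∈ Metric.sphere α r) :
    z - α ≠ 0 := by
  intro h0
  rw [mem_sphere_iff_norm, h0, norm_zero] at hz
  exact hr.1.ne hz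

theorem mono (hr : IsIsolatingRadius a α r) {s : ℝ} (hs : 0 < s) (hsr : s ≤ r) :
    IsIsolatingRadius a α s :=
  ⟨hs, (Set.inter_subset_inter_left _ (Metric.closedBall_subset_closedBall hsr)).trans hr.2⟩

variable [CompleteSpace A]

theorem continuousOn_resolvent (hr : IsIsolatingRadius a α r) :
    ContinuousOn (resolvent a) (Metric.sphere α r) := fun _ hz =>
  (spectrum.hasDerivAt_resolvent_const_left
    (hr.mem_resolventSet hz)).continuousAt.continuousWithinAt

theorem circleIntegrable_zpow_smul (hr : IsIsolatingRadius a α r) (n : ℤ) :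
    CircleIntegrable (fun z => (z - α) ^ n • resolvent a z) α r := by
  refine ContinuousOn.circleIntegrable hr.1.le (ContinuousOn.smul ?_ hr.continuousOn_resolvent)
  exact ContinuousOn.zpow₀ (by fun_prop) n fun z hz => Or.inl (hr.sub_ne_zero hz)

theorem norm_resolventMoment_le (hr : IsIsolatingRadius a α r) :
    ∃ K, ∀ n : ℤ, ‖resolventMoment a α r n‖ ≤ K * r ^ n := by
  obtain ⟨K, hK⟩ := (isCompact_sphere α r).exists_bound_of_continuousOn hr.continuousOn_resolvent
  refine ⟨r * K, fun n => ?_⟩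
  have h := circleIntegral.norm_two_pi_i_inv_smul_integral_le_of_norm_le_const hr.1.le
    (f := fun z => (z - α) ^ n • resolvent a z) (C := r ^ n * K) (c := α) fun z hz => by
      have hz' : ‖z - α‖ = r := by simpa [dist_eq_norm] using hz
      rw [norm_smul, norm_zpow, hz']
      have := hr.1
      gcongr
      exact hK z hz
  calc _ ≤ _ := h
    _ = _ := by ring

theorem mul_left_resolventMoment (hr : IsIsolatingRadius a α r) (x : A) (n : ℤ) :
    x * resolventMoment a α r n =
      (2 * Real.pi * Complex.I : ℂ)⁻¹ • ∮ z in C(α, r), (z - α) ^ n • (x * resolvent a z) := by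
  rw [resolventMoment, mul_smul_comm, circleIntegral, circleIntegral]
  congr 1
  have h := (ContinuousLinearMap.mul ℂ A x).intervalIntegral_comp_comm
    (hr.circleIntegrable_zpow_smul n).out
  simpa using h.symm

theorem mul_right_resolventMoment (hr : IsIsolatingRadius a α r) (x : A) (n : ℤ) :
    resolventMoment a α r n * x =
      (2 * Real.pi * Complex.I : ℂ)⁻¹ • ∮ z in C(α, r), (z - α) ^ n • (resolvent a z * x) := by
  rw [resolventMoment, smul_mul_assoc, circleIntegral, circleIntegral]
  congr 1
  have h := ((ContinuousLinearMap.mul ℂ A).flip x).intervalIntegral_comp_comm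
    (hr.circleIntegrable_zpow_smul n).out
  simpa using h.symm

theorem commute_resolventMoment (hr : IsIsolatingRadius a α r) {x : A} (hx : Commute x a) (n : ℤ) :
    Commute x (resolventMoment a α r n) := by
  rw [commute_iff_eq, hr.mul_left_resolventMoment, hr.mul_right_resolventMoment]
  congr 2
  ext z
  have h : Commute x (algebraMap ℂ A z - a) := (Algebra.commute_algebraMap_right z x).sub_right hx
  have : Commute x (resolvent a z) := by
    rw [resolvent]
    by_cases hu : IsUnit (algebraMap ℂ A z - a)
    · obtain ⟨u, hu⟩ := hu
      rw [← hu] at h ⊢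
      rw [Ring.inverse_unit]
      exact h.units_inv_right
    · rw [Ring.inverse_non_unit _ hu]
      exact Commute.zero_right x
  rw [this.eq]

/-- The recursion for the moments, from `(a - α) R(z) = (z - α) R(z) - 1`. -/
theorem sub_mul_resolventMoment (hr : IsIsolatingRadius a α r) (n : ℤ) :
    (a - algebraMap ℂ A α) * resolventMoment a α r n =
      resolventMoment a α r (n + 1) - if n = -1 then 1 else 0 := by
  have h1 : (∮ z in C(α, r), (z - α) ^ n • ((a - algebraMap ℂ A α) * resolvent a z)) =
      (∮ z in C(α, r), (z - α) ^ (n + 1) • resolvent a z) -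
        ∮ z in C(α, r), (z - α) ^ n • (1 : A) := by
    rw [← circleIntegral.integral_sub (hr.circleIntegrable_zpow_smul _)]
    · refine circleIntegral.integral_congr hr.1.le fun z hz => ?_
      have h2 : (algebraMap ℂ A z - a) * resolvent a z = 1 :=
        Ring.mul_inverse_cancel _ (hr.mem_resolventSet hz)
      have h3 : (a - algebraMap ℂ A α) * resolvent a z = (z - α) • resolvent a z - 1 := by
        rw [← h2, Algebra.smul_def, map_sub]
        noncomm_ring
      simp only [h3, smul_sub, smul_smul, zpow_add_one₀ (hr.sub_ne_zero hz)]
    · refine ContinuousOn.circleIntegrable hr.1.le (ContinuousOn.smul ?_ continuousOn_const)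
      exact ContinuousOn.zpow₀ (by fun_prop) n fun z hz => Or.inl (hr.sub_ne_zero hz)
  rw [hr.mul_left_resolventMoment, h1, smul_sub, ← resolventMoment]
  congr 1
  rw [circleIntegral.integral_smul_const]
  split_ifs with hn
  · subst hn
    have h4 := circleIntegral.integral_sub_center_inv α hr.1.ne'
    simp only [zpow_neg_one]
    rw [h4, smul_smul, inv_mul_cancel₀ Complex.two_pi_I_ne_zero, one_smul]
  · rw [circleIntegral.integral_sub_zpow_of_ne hn, zero_smul, smul_zero]

theorem rieszProjection_eq_resolventMoment (hr : IsIsolatingRadius a α r) :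
    rieszProjection a α = resolventMoment a α r 0 := by
  rw [rieszProjection_eq hr, resolventMoment]
  simp

theorem sub_pow_mul_rieszProjection (hr : IsIsolatingRadius a α r) (n : ℕ) :
    (a - algebraMap ℂ A α) ^ n * rieszProjection a α = resolventMoment a α r n := by
  induction n with
  | zero => simp [hr.rieszProjection_eq_resolventMoment]
  | succ n ih =>
    rw [pow_succ', mul_assoc, ih, hr.sub_mul_resolventMoment, if_neg (by lia), sub_zero]
    norm_cast

theorem sub_pow_mul_resolventMoment_neg (hr : IsIsolatingRadius a α r) (n : ℕ) :
    (a - algebraMap ℂ A α) ^ n * resolventMoment a α r (-1 - n) = resolventMoment a α r (-1) := by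
  induction n with
  | zero => simp
  | succ n ih =>
    rw [pow_succ, mul_assoc, hr.sub_mul_resolventMoment, if_neg (by push_cast; lia), sub_zero,
      ← ih]
    congr 2
    push_cast
    ring

theorem commute_rieszProjection (hr : IsIsolatingRadius a α r) {x : A} (hx : Commute x a) :
    Commute x (rieszProjection a α) := by
  rw [hr.rieszProjection_eq_resolventMoment]
  exact hr.commute_resolventMoment hx 0

/-- On the range of its Riesz projection, `a - α` is quasinilpotent. -/
theorem norm_sub_pow_mul_rieszProjection_le (hr : IsIsolatingRadius a α r) {s : ℝ} (hs : 0 < s) :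
    ∃ K, ∀ n : ℕ, ‖(a - algebraMap ℂ A α) ^ n * rieszProjection a α‖ ≤ K * s ^ n := by
  have ht : 0 < min s r := lt_min hs hr.1
  have ht' := hr.mono ht (min_le_right s r)
  obtain ⟨K, hK⟩ := ht'.norm_resolventMoment_le
  have hK0 : 0 ≤ K := by simpa using (norm_nonneg _).trans (hK 0)
  refine ⟨K, fun n => ?_⟩
  rw [ht'.sub_pow_mul_rieszProjection]
  calc _ ≤ K * (min s r) ^ (n : ℤ) := hK n
    _ ≤ K * s ^ n := by
      rw [zpow_natCast]
      gcongr
      exact min_le_left _ _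

/-- Off the range of its Riesz projection, `a - α` is invertible. -/
theorem exists_sub_mul_eq_one_sub (hr : IsIsolatingRadius a α r) :
    ∃ c : A, (∀ x, Commute x a → Commute x c) ∧
      (a - algebraMap ℂ A α) * c = 1 - rieszProjection a α := by
  refine ⟨-resolventMoment a α r (-1), fun x hx => (hr.commute_resolventMoment hx _).neg_right, ?_⟩
  rw [mul_neg, hr.sub_mul_resolventMoment, hr.rieszProjection_eq_resolventMoment]
  simp

theorem isIdempotentElem_rieszProjection (hr : IsIsolatingRadius a α r) :
    IsIdempotentElem (rieszProjection a α) := by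
  have hcomm : Commute (a - algebraMap ℂ A α) (rieszProjection a α) :=
    hr.commute_rieszProjection ((Commute.refl a).sub_left (Algebra.commutes α a))
  -- The zeroth Laurent coefficient is annihilated: it equals `(a - α)ⁿ` times a moment of size
  -- `r ^ (-1 - n)`, while `(a - α)ⁿ p` decays faster than `(r / 2) ^ n`.
  have hzero : rieszProjection a α * resolventMoment a α r (-1) = 0 := by
    obtain ⟨K, hK⟩ := hr.norm_resolventMoment_le
    obtain ⟨M, hM⟩ := hr.norm_sub_pow_mul_rieszProjection_le (half_pos hr.1)
    have hr0 := hr.1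
    have hM0 : 0 ≤ M := by simpa using (norm_nonneg _).trans (hM 0)
    refine eq_zero_of_forall_norm_le (K := M * K * r⁻¹) (s := 1 / 2) (by norm_num) (by norm_num)
      fun n => ?_
    rw [← hr.sub_pow_mul_resolventMoment_neg n, ← mul_assoc, ← (hcomm.pow_left n).eq]
    calc _ ≤ _ := norm_mul_le _ _
      _ ≤ (M * (r / 2) ^ n) * (K * r ^ (-1 - n : ℤ)) := by
        gcongr
        exacts [hM n, hK _]
      _ = _ := by
        rw [sub_eq_add_neg, zpow_add₀ hr0.ne', zpow_neg_one, zpow_neg, zpow_natCast, div_pow,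
          div_pow]
        field_simp
        ring
  have h1 := hr.sub_mul_resolventMoment (-1)
  simp only [if_true, neg_add_cancel, ← hr.rieszProjection_eq_resolventMoment] at h1
  have h2 : rieszProjection a α * (rieszProjection a α - 1) = 0 := by
    rw [← h1, ← mul_assoc, ← hcomm.eq, mul_assoc, hzero, mul_zero]
  rw [mul_sub, mul_one, sub_eq_zero] at h2
  exact h2

theorem rieszProjection_ne_zero (hr : IsIsolatingRadius a α r) (hα : α ∈ spectrum ℂ a) :
    rieszProjection a α ≠ 0 := by
  intro h0
  obtain ⟨c, hc, hac⟩ := hr.exists_sub_mul_eq_one_sub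
  rw [h0, sub_zero] at hac
  have hca : Commute (a - algebraMap ℂ A α) c :=
    hc _ ((Commute.refl a).sub_left (Algebra.commutes α a))
  refine spectrum.mem_iff.1 hα ?_
  rw [← neg_sub, IsUnit.neg_iff]
  exact ⟨⟨_, c, hac, hca.eq ▸ hac⟩, rfl⟩

theorem rieszProjection_eq_zero (hr : IsIsolatingRadius a α r) (hα : α ∉ spectrum ℂ a) :
    rieszProjection a α = 0 := by
  rw [rieszProjection_eq hr]
  have hd : ∀ z ∈ Metric.closedBall α r, DifferentiableAt ℂ (resolvent a) z := fun z hz =>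
    (spectrum.hasDerivAt_resolvent_const_left (by
      by_contra hmem
      have : z = α := hr.2 ⟨hz, hmem⟩
      exact hα (this ▸ hmem))).differentiableAt
  rw [Complex.circleIntegral_eq_zero_of_differentiable_on_off_countable hr.1.le
    Set.countable_empty (fun z hz => (hd z hz).continuousAt.continuousWithinAt)
    (fun z hz => hd z (Metric.ball_subset_closedBall hz.1)), smul_zero]

end IsIsolatingRadius

/-! ### The operator `C_{a,b}` and its growth at `1` -/

theorem commutatorOp_apply (a b x : A) : commutatorOp a b x = a * x - x * b := rfl

theorem commutatorOp_pow_mul {a b p q : A} (hp : Commute a p) (hq : Commute b q) (x : A) (n : ℕ) :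
    (commutatorOp a b ^ n) (p * x * q) = p * (commutatorOp a b ^ n) x * q := by
  induction n with
  | zero => simp
  | succ n ih =>
    rw [pow_succ', Module.End.mul_apply, ih, Module.End.mul_apply, commutatorOp_apply,
      commutatorOp_apply, mul_sub, sub_mul]
    congr 1
    · simp only [← mul_assoc, hp.eq]
    · simp only [mul_assoc, hq.eq]

theorem norm_commutatorOp_pow_le (a b x : A) (n : ℕ) :
    ‖(commutatorOp a b ^ n) x‖ ≤ ‖x‖ * (‖a‖ + ‖b‖) ^ n := by
  induction n with
  | zero => simp
  | succ n ih =>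
    rw [pow_succ', Module.End.mul_apply, commutatorOp_apply]
    calc _ ≤ ‖a * _‖ + ‖_ * b‖ := norm_sub_le _ _
      _ ≤ ‖a‖ * ‖(commutatorOp a b ^ n) x‖ + ‖(commutatorOp a b ^ n) x‖ * ‖b‖ := by
        gcongr <;> exact norm_mul_le _ _
      _ = ‖(commutatorOp a b ^ n) x‖ * (‖a‖ + ‖b‖) := by ring
      _ ≤ (‖x‖ * (‖a‖ + ‖b‖) ^ n) * (‖a‖ + ‖b‖) := by gcongr
      _ = _ := by ring

theorem isBoundedUnder_varrho (a b : A) : IsBoundedUnder (· ≤ ·) atTop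
    fun n : ℕ => ‖(commutatorOp a b ^ n) 1‖ ^ (1 / (n : ℝ)) := by
  have h := (tendsto_rpow_one_div_mul (K := ‖(1 : A)‖ + 1) (by positivity)
    (‖a‖ + ‖b‖)).isBoundedUnder_le
  refine h.mono_le ?_
  filter_upwards [eventually_ne_atTop 0] with n hn
  refine rpow_one_div_le_of_le_mul_pow (norm_nonneg _) (by positivity) (by positivity) hn
    ((norm_commutatorOp_pow_le a b 1 n).trans ?_)
  gcongr
  linarith

theorem varrho_nonneg (a b : A) : 0 ≤ varrho a b :=
  le_limsup_of_frequently_le (Frequently.of_forall fun n => by positivity)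
    (isBoundedUnder_varrho a b)

theorem exists_norm_le_of_varrho_lt {a b : A} {r : ℝ} (h : varrho a b < r) :
    ∃ K, ∀ n, ‖(commutatorOp a b ^ n) 1‖ ≤ K * r ^ n := by
  refine exists_le_mul_pow_of_eventually ((varrho_nonneg a b).trans_lt h) ?_
  filter_upwards [eventually_lt_of_limsup_lt h (isBoundedUnder_varrho a b), eventually_ne_atTop 0]
    with n hn hn0
  exact le_pow_of_rpow_one_div_le (norm_nonneg _) hn0 hn.le

theorem varrho_le_of_norm_le {a b : A} {r K : ℝ} (hr : 0 ≤ r)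
    (h : ∀ n, ‖(commutatorOp a b ^ n) 1‖ ≤ K * r ^ n) : varrho a b ≤ r := by
  have hK0 : 0 ≤ K := by simpa using (norm_nonneg _).trans (h 0)
  have ht := tendsto_rpow_one_div_mul (K := K + 1) (by positivity) r
  rw [← ht.limsup_eq]
  refine limsup_le_limsup ?_ ?_ ht.isBoundedUnder_le
  · filter_upwards [eventually_ne_atTop 0] with n hn
    refine rpow_one_div_le_of_le_mul_pow (norm_nonneg _) (by positivity) hr hn ((h n).trans ?_)
    gcongr
    linarith
  · exact (isBoundedUnder_of ⟨0, fun n => by positivity⟩ :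
      IsBoundedUnder (· ≥ ·) atTop _).isCoboundedUnder_le

/-- `x` grows under `C_{a,b}` at a geometric rate strictly below `ρ`. -/
def GrowsBelow (a b : A) (ρ : ℝ) (x : A) : Prop :=
  ∃ r, 0 ≤ r ∧ r < ρ ∧ ∃ K, ∀ n, ‖(commutatorOp a b ^ n) x‖ ≤ K * r ^ n

theorem GrowsBelow.zero (a b : A) {ρ : ℝ} (hρ : 0 < ρ) : GrowsBelow a b ρ 0 :=
  ⟨0, le_rfl, hρ, 0, fun n => by simp⟩

theorem GrowsBelow.add {a b : A} {ρ : ℝ} {x y : A} (hx : GrowsBelow a b ρ x)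
    (hy : GrowsBelow a b ρ y) : GrowsBelow a b ρ (x + y) := by
  obtain ⟨r, hr, hrρ, K, hK⟩ := hx
  obtain ⟨s, hs, hsρ, M, hM⟩ := hy
  have hK0 : 0 ≤ K := by simpa using (norm_nonneg _).trans (hK 0)
  have hM0 : 0 ≤ M := by simpa using (norm_nonneg _).trans (hM 0)
  refine ⟨max r s, le_max_of_le_left hr, max_lt hrρ hsρ, K + M, fun n => ?_⟩
  rw [map_add]
  calc _ ≤ _ := norm_add_le _ _
    _ ≤ K * r ^ n + M * s ^ n := add_le_add (hK n) (hM n)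
    _ ≤ K * (max r s) ^ n + M * (max r s) ^ n := by
      gcongr
      exacts [le_max_left _ _, le_max_right _ _]
    _ = _ := by ring

theorem GrowsBelow.sum {ι : Type*} {a b : A} {ρ : ℝ} (hρ : 0 < ρ) (s : Finset ι) {f : ι → A}
    (h : ∀ i ∈ s, GrowsBelow a b ρ (f i)) : GrowsBelow a b ρ (∑ i ∈ s, f i) :=
  Finset.sum_induction f _ (fun _ _ => GrowsBelow.add) (GrowsBelow.zero a b hρ) h

theorem GrowsBelow.varrho_lt {a b : A} {ρ : ℝ} (h : GrowsBelow a b ρ 1) : varrho a b < ρ := by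
  obtain ⟨r, hr, hrρ, K, hK⟩ := h
  exact (varrho_le_of_norm_le hr hK).trans_lt hrρ

/-- If three commuting operators have joint orbits of `v` bounded geometrically with ratios `r`,
`s`, `t`, then the orbit of `v` under their sum is bounded with ratio `r + s + t`. -/
theorem norm_add_add_pow_apply_le {E : Type*} [NormedAddCommGroup E] [Module ℂ E]
    {X Y Z : Module.End ℂ E} (hXY : Commute X Y) (hXZ : Commute X Z) (hYZ : Commute Y Z) {v : E}
    {K r s t : ℝ}
    (h : ∀ i j k : ℕ, ‖(X ^ i) ((Y ^ j) ((Z ^ k) v))‖ ≤ K * r ^ i * s ^ j * t ^ k) (m : ℕ) :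
    ‖((X + Y + Z) ^ m) v‖ ≤ K * (r + s + t) ^ m := by
  suffices H : ∀ m i j k : ℕ, ‖(X ^ i * Y ^ j * Z ^ k * (X + Y + Z) ^ m) v‖ ≤
      K * r ^ i * s ^ j * t ^ k * (r + s + t) ^ m by
    simpa using H m 0 0 0
  intro m
  induction m with
  | zero => intro i j k; simpa [Module.End.mul_apply] using h i j k
  | succ m ih =>
    intro i j k
    have e : X ^ i * Y ^ j * Z ^ k * (X + Y + Z) ^ (m + 1) =
        X ^ (i + 1) * Y ^ j * Z ^ k * (X + Y + Z) ^ m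
        + X ^ i * Y ^ (j + 1) * Z ^ k * (X + Y + Z) ^ m
        + X ^ i * Y ^ j * Z ^ (k + 1) * (X + Y + Z) ^ m := by
      have e1 : X ^ i * Y ^ j * Z ^ k * X = X ^ (i + 1) * Y ^ j * Z ^ k := by
        rw [mul_assoc, ← (hXZ.pow_right k).eq, mul_assoc, ← mul_assoc (Y ^ j),
          ← (hXY.pow_right j).eq, pow_succ]
        simp only [mul_assoc]
      have e2 : X ^ i * Y ^ j * Z ^ k * Y = X ^ i * Y ^ (j + 1) * Z ^ k := by
        rw [mul_assoc, ← (hYZ.pow_right k).eq, pow_succ]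
        simp only [mul_assoc]
      rw [pow_succ', ← mul_assoc, mul_add, mul_add, e1, e2, mul_assoc _ (Z ^ k) Z, ← pow_succ,
        add_mul, add_mul]
    rw [e, LinearMap.add_apply, LinearMap.add_apply]
    calc _ ≤ _ := norm_add₃_le
      _ ≤ _ := add_le_add (add_le_add (ih _ _ _) (ih _ _ _)) (ih _ _ _)
      _ = _ := by ring

/-! ### Spectral pieces -/

/-- `p` commutes with `a`, and on its range `a - α` has spectral radius at most `s`, in the sense
that `‖(a - α)ⁿ p‖` is bounded geometrically with any ratio above `s`. The element `p` is not
required to be idempotent. -/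
structure IsSpectralPiece (a p : A) (α : ℂ) (s : ℝ) : Prop where
  commute : Commute a p
  exists_norm_le : ∀ r, s < r → ∃ K, ∀ n : ℕ, ‖(a - algebraMap ℂ A α) ^ n * p‖ ≤ K * r ^ n

/-- The operator `x ↦ (a - α) x`. -/
noncomputable def leftShift (a : A) (α : ℂ) : Module.End ℂ A := LinearMap.mulLeft ℂ (a - algebraMap ℂ A α)

/-- The operator `x ↦ x (b - β)`. -/
noncomputable def rightShift (b : A) (β : ℂ) : Module.End ℂ A := LinearMap.mulRight ℂ (b - algebraMap ℂ A β)

theorem leftShift_pow_apply (a : A) (α : ℂ) (n : ℕ) (x : A) :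
    (leftShift a α ^ n) x = (a - algebraMap ℂ A α) ^ n * x := by
  rw [leftShift, LinearMap.pow_mulLeft, LinearMap.mulLeft_apply]

theorem rightShift_pow_apply (b : A) (β : ℂ) (n : ℕ) (x : A) :
    (rightShift b β ^ n) x = x * (b - algebraMap ℂ A β) ^ n := by
  rw [rightShift, LinearMap.pow_mulRight, LinearMap.mulRight_apply]

theorem commutatorOp_eq (a b : A) (α β : ℂ) :
    commutatorOp a b = leftShift a α + -rightShift b β + (α - β) • (1 : Module.End ℂ A) := by
  ext x
  simp only [commutatorOp_apply, leftShift, rightShift, LinearMap.add_apply, LinearMap.neg_apply,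
    LinearMap.smul_apply, LinearMap.mulLeft_apply, LinearMap.mulRight_apply, Module.End.one_apply,
    sub_smul, sub_mul, mul_sub, ← Algebra.smul_def, ← Algebra.commutes β x, LinearMap.sub_apply]
  abel

theorem commute_leftShift_rightShift (a b : A) (α β : ℂ) :
    Commute (leftShift a α) (rightShift b β) :=
  LinearMap.commute_mulLeft_right _ _

theorem commute_leftShift_commutatorOp (a b : A) (α : ℂ) :
    Commute (leftShift a α) (commutatorOp a b) := by
  rw [commutatorOp_eq a b α 0]
  exact ((Commute.refl _).add_right (commute_leftShift_rightShift a b α 0).neg_right).add_right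
    ((Commute.one_right _).smul_right _)

theorem commute_rightShift_commutatorOp (a b : A) (β : ℂ) :
    Commute (rightShift b β) (commutatorOp a b) := by
  rw [commutatorOp_eq a b 0 β]
  exact ((commute_leftShift_rightShift a b 0 β).symm.add_right (Commute.refl _).neg_right).add_right
    ((Commute.one_right _).smul_right _)

namespace IsSpectralPiece

variable {a b p q : A} {α β : ℂ} {s t : ℝ}

theorem commute_sub (hp : IsSpectralPiece a p α s) : Commute (a - algebraMap ℂ A α) p :=
  hp.commute.sub_left (Algebra.commutes α p)

/-- Upper bound for the growth of a product of pieces: there `C_{a,b}` is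
`(α - β) + (a - α) · - · (b - β)`. -/
theorem growsBelow (hp : IsSpectralPiece a p α s) (hq : IsSpectralPiece b q β t) (hs : 0 ≤ s)
    (ht : 0 ≤ t) {ρ : ℝ} (hρ : ‖α - β‖ + s + t < ρ) : GrowsBelow a b ρ (p * q) := by
  set δ := (ρ - (‖α - β‖ + s + t)) / 4 with hδ
  have hδ0 : 0 < δ := by rw [hδ]; linarith
  obtain ⟨K, hK⟩ := hp.exists_norm_le (s + δ) (by linarith)
  obtain ⟨M, hM⟩ := hq.exists_norm_le (t + δ) (by linarith)
  have hK0 : 0 ≤ K := by simpa using (norm_nonneg _).trans (hK 0)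
  refine ⟨(s + δ) + (t + δ) + ‖α - β‖, by positivity, by rw [hδ]; linarith, K * M, fun n => ?_⟩
  rw [commutatorOp_eq a b α β]
  refine norm_add_add_pow_apply_le (commute_leftShift_rightShift a b α β).neg_right
    ((Commute.one_right _).smul_right _) ((Commute.one_right _).smul_right _) (fun i j k => ?_) n
  rw [smul_pow, one_pow, LinearMap.smul_apply, Module.End.one_apply, map_smul, map_smul, norm_smul,
    norm_pow, mul_comm (‖α - β‖ ^ k), neg_pow, Module.End.mul_apply, rightShift_pow_apply]
  have e : ∀ x : A, ‖(leftShift a α ^ i) (((-1 : Module.End ℂ A) ^ j) x)‖ =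
      ‖(leftShift a α ^ i) x‖ := fun x => by
    rcases neg_one_pow_eq_or (Module.End ℂ A) j with h | h <;> simp [h]
  rw [e, leftShift_pow_apply]
  gcongr
  calc _ = ‖((a - algebraMap ℂ A α) ^ i * p) * ((b - algebraMap ℂ A β) ^ j * q)‖ := by
        rw [(hq.commute_sub.pow_left j).eq]
        simp only [mul_assoc]
    _ ≤ _ := norm_mul_le _ _
    _ ≤ (K * (s + δ) ^ i) * (M * (t + δ) ^ j) := by
      gcongr
      exacts [hK i, hM j]
    _ = _ := by ring

/-- Lower bound: a nonzero product of pieces forces `C_{a,b}` to grow, since `α - β` is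
`C_{a,b} - (a - α) · + · (b - β)`. -/
theorem norm_sub_le (hp : IsSpectralPiece a p α s) (hq : IsSpectralPiece b q β t) (hs : 0 ≤ s)
    (ht : 0 ≤ t) (hpq : p * q ≠ 0) : ‖α - β‖ ≤ varrho a b + s + t := by
  refine le_of_forall_pos_le_add fun ε hε => ?_
  have hρ := varrho_nonneg a b
  set δ := ε / 3 with hδ
  have hδ0 : 0 < δ := by positivity
  obtain ⟨N, hN⟩ := exists_norm_le_of_varrho_lt (lt_add_of_pos_right (varrho a b) hδ0)
  obtain ⟨K, hK⟩ := hp.exists_norm_le (s + δ) (by linarith)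
  obtain ⟨M, hM⟩ := hq.exists_norm_le (t + δ) (by linarith)
  have hK0 : 0 ≤ K := by simpa using (norm_nonneg _).trans (hK 0)
  have hN0 : 0 ≤ N := by simpa using (norm_nonneg _).trans (hN 0)
  have key : ‖α - β‖ ≤ (s + δ) + (t + δ) + (varrho a b + δ) := by
    refine le_of_pow_mul_le (norm_pos_iff.2 hpq) (by positivity) (K := K * M * N) fun n => ?_
    have e0 : (α - β) • (1 : Module.End ℂ A) =
        -leftShift a α + rightShift b β + commutatorOp a b := by
      rw [commutatorOp_eq a b α β]; abel
    have e1 : ‖α - β‖ ^ n * ‖p * q‖ = ‖(((α - β) • (1 : Module.End ℂ A)) ^ n) (p * q)‖ := by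
      rw [smul_pow, one_pow, LinearMap.smul_apply, Module.End.one_apply, norm_smul, norm_pow]
    rw [e1, e0]
    refine norm_add_add_pow_apply_le (commute_leftShift_rightShift a b α β).neg_left
      (commute_leftShift_commutatorOp a b α).neg_left
      (commute_rightShift_commutatorOp a b β) (fun i j k => ?_) n
    have e : ∀ x : A, ‖((-leftShift a α) ^ i) x‖ = ‖(leftShift a α ^ i) x‖ := fun x => by
      rw [neg_pow, Module.End.mul_apply]
      rcases neg_one_pow_eq_or (Module.End ℂ A) i with h | h <;> simp [h]
    rw [e, rightShift_pow_apply, leftShift_pow_apply]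
    have hC := commutatorOp_pow_mul hp.commute hq.commute 1 k
    rw [mul_one] at hC
    calc _ = ‖((a - algebraMap ℂ A α) ^ i * p) * (commutatorOp a b ^ k) 1 *
          ((b - algebraMap ℂ A β) ^ j * q)‖ := by
          rw [hC, (hq.commute_sub.pow_left j).eq]
          simp only [mul_assoc]
      _ ≤ _ := (norm_mul_le _ _).trans
        (mul_le_mul_of_nonneg_right (norm_mul_le _ _) (norm_nonneg _))
      _ ≤ ((K * (s + δ) ^ i) * (N * (varrho a b + δ) ^ k)) * (M * (t + δ) ^ j) := by
        gcongr
        exacts [hK i, hN k, hM j]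
      _ = _ := by ring
  linarith

/-- If `ϱ(a,b) = 0`, a piece of `a` at `α` is also a left piece of `b` at `α`. -/
theorem exists_norm_mul_sub_pow_le (hp : IsSpectralPiece a p α 0) (h0 : varrho a b = 0) {r : ℝ}
    (hr : 0 < r) : ∃ K, ∀ n : ℕ, ‖p * (b - algebraMap ℂ A α) ^ n‖ ≤ K * r ^ n := by
  obtain ⟨N, hN⟩ := exists_norm_le_of_varrho_lt (a := a) (b := b) (r := r / 2) (by linarith)
  obtain ⟨K, hK⟩ := hp.exists_norm_le (r / 2) (by linarith)
  have hK0 : 0 ≤ K := by simpa using (norm_nonneg _).trans (hK 0)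
  refine ⟨K * N, fun n => ?_⟩
  have e : rightShift b α = leftShift a α + -commutatorOp a b + 0 := by
    rw [commutatorOp_eq a b α α]; simp
  have hr2 : r = r / 2 + r / 2 + 0 := by ring
  rw [← rightShift_pow_apply, e]
  rw [hr2]
  refine norm_add_add_pow_apply_le (commute_leftShift_commutatorOp a b α).neg_right
    (Commute.zero_right _) (Commute.zero_right _) (fun i j k => ?_) n
  rcases k.eq_zero_or_pos with rfl | hk
  · have hC := commutatorOp_pow_mul hp.commute (Commute.one_right b) 1 j
    simp only [mul_one] at hC
    have e : ∀ x : A, ‖(leftShift a α ^ i) (((-1 : Module.End ℂ A) ^ j) x)‖ =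
        ‖(leftShift a α ^ i) x‖ := fun x => by
      rcases neg_one_pow_eq_or (Module.End ℂ A) j with h | h <;> simp [h]
    rw [pow_zero, pow_zero, Module.End.one_apply, neg_pow, Module.End.mul_apply, e, hC,
      leftShift_pow_apply, ← mul_assoc]
    calc _ ≤ _ := norm_mul_le _ _
      _ ≤ (K * (r / 2) ^ i) * (N * (r / 2) ^ j) := by
        gcongr
        exacts [hK i, hN j]
      _ = _ := by ring
  · simp [zero_pow hk.ne']

/-- If `ϱ(a,b) = 0`, a piece of `b` at `β` is also a right piece of `a` at `β`. -/
theorem exists_norm_sub_pow_mul_le (hq : IsSpectralPiece b q β 0) (h0 : varrho a b = 0) {r : ℝ}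
    (hr : 0 < r) : ∃ K, ∀ n : ℕ, ‖(a - algebraMap ℂ A β) ^ n * q‖ ≤ K * r ^ n := by
  obtain ⟨N, hN⟩ := exists_norm_le_of_varrho_lt (a := a) (b := b) (r := r / 2) (by linarith)
  obtain ⟨K, hK⟩ := hq.exists_norm_le (r / 2) (by linarith)
  have hN0 : 0 ≤ N := by simpa using (norm_nonneg _).trans (hN 0)
  refine ⟨N * K, fun n => ?_⟩
  have e : leftShift a β = rightShift b β + commutatorOp a b + 0 := by
    rw [commutatorOp_eq a b β β]; simp
  have hr2 : r = r / 2 + r / 2 + 0 := by ring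
  rw [← leftShift_pow_apply, e]
  rw [hr2]
  refine norm_add_add_pow_apply_le (commute_rightShift_commutatorOp a b β)
    (Commute.zero_right _) (Commute.zero_right _) (fun i j k => ?_) n
  rcases k.eq_zero_or_pos with rfl | hk
  · have hC := commutatorOp_pow_mul (Commute.one_right a) hq.commute 1 j
    simp only [one_mul] at hC
    rw [pow_zero, pow_zero, Module.End.one_apply, hC, rightShift_pow_apply, mul_assoc,
      ← (hq.commute_sub.pow_left i).eq]
    calc _ ≤ _ := norm_mul_le _ _
      _ ≤ (N * (r / 2) ^ j) * (K * (r / 2) ^ i) := by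
        gcongr
        exacts [hN j, hK i]
      _ = _ := by ring
  · simp [zero_pow hk.ne']

end IsSpectralPiece

/-! ### Isolated spectral values and the decomposition of the identity -/

theorem varrho_self (a : A) : varrho a a = 0 := by
  refine le_antisymm (varrho_le_of_norm_le (K := ‖(1 : A)‖) le_rfl fun n => ?_)
    (varrho_nonneg a a)
  rcases n with _ | n
  · simp
  · simp [pow_succ, commutatorOp_apply]

theorem exists_isIsolatingRadius {a : A} {α : ℂ}
    (h : ¬ AccPt α (𝓟 (nonzeroSpectrum a))) : ∃ r, IsIsolatingRadius a α r := by
  rw [accPt_iff_nhds] at h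
  push Not at h
  obtain ⟨U, hU, hUa⟩ := h
  have hV : {z : ℂ | α ≠ 0 → z ≠ 0} ∈ 𝓝 α := by
    by_cases hα : α = 0
    · simp [hα]
    · simpa [hα] using isOpen_ne.mem_nhds hα
  obtain ⟨r, hr, hball⟩ := Metric.nhds_basis_closedBall.mem_iff.1 (inter_mem hU hV)
  refine ⟨r, hr, fun z hz => ?_⟩
  have hzU := hball hz.1
  by_cases hz0 : z = 0
  · by_contra hne
    exact hzU.2 (fun hα => hne (by simp [hz0, hα])) hz0
  · exact hUa z ⟨hzU.1, hz.2, hz0⟩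

theorem ClustersOnlyAtZero.exists_isIsolatingRadius {a : A}
    (ha : ClustersOnlyAtZero (nonzeroSpectrum a)) {α : ℂ} (hα : α ≠ 0) :
    ∃ r, IsIsolatingRadius a α r :=
  RieszSpectral.exists_isIsolatingRadius fun h => hα (ha α h)

/-- If `e` is an idempotent commuting with `a` and `a - z` is invertible on its range, then the
nonzero number `z` is not a spectral value of `a e`. -/
theorem notMem_spectrum_mul_of_sub_mul_eq {a e : A} {z : ℂ} (hz : z ≠ 0)
    (he : IsIdempotentElem e) (hae : Commute a e) {c q : A} (hac : Commute a c) (hec : Commute e c)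
    (hc : (a - algebraMap ℂ A z) * c = 1 - q) (hq : q * e = 0) : z ∉ spectrum ℂ (a * e) := by
  rw [spectrum.notMem_iff]
  -- The inverse of `z - a e` is `-c` on the range of `e` and `z⁻¹` on the range of `1 - e`.
  set v : A := z⁻¹ • (1 - e) - c * e with hv
  have hcomm : Commute (algebraMap ℂ A z - a * e) v := by
    refine (Algebra.commute_algebraMap_left z v).sub_left (Commute.mul_left ?_ ?_)
    · exact (((Commute.one_right a).sub_right hae).smul_right _).sub_right (hac.mul_right hae)
    · exact (((Commute.one_right e).sub_right (Commute.refl e)).smul_right _).sub_right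
        (hec.mul_right (Commute.refl e))
  have h1 : a * e * (c * e) = a * c * e := by
    rw [mul_assoc, ← mul_assoc e, hec.eq, mul_assoc c, he.eq, mul_assoc]
  have h2 : a * c = 1 - q + z • c := by
    rw [← hc, sub_mul, Algebra.smul_def, sub_add_cancel]
  have h3 : a * e * (1 - e) = 0 := by rw [mul_assoc, mul_sub, mul_one, he.eq, sub_self, mul_zero]
  have h4 : (algebraMap ℂ A z - a * e) * v = 1 := by
    rw [hv, sub_mul, mul_sub (a * e), mul_smul_comm, h3, h1, h2, ← Algebra.smul_def, smul_sub,
      smul_smul, mul_inv_cancel₀ hz, one_smul, add_mul, sub_mul, one_mul, hq, smul_mul_assoc,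
      smul_zero]
    abel
  exact ⟨⟨_, v, h4, hcomm.eq ▸ h4⟩, rfl⟩

variable [CompleteSpace A]

theorem IsIsolatingRadius.isSpectralPiece {a : A} {α : ℂ} {r : ℝ} (hr : IsIsolatingRadius a α r) :
    IsSpectralPiece a (rieszProjection a α) α 0 :=
  ⟨hr.commute_rieszProjection (Commute.refl a), fun _ hs =>
    hr.norm_sub_pow_mul_rieszProjection_le hs⟩

theorem IsIsolatingRadius.mem_spectrum_iff {a : A} {α : ℂ} {r : ℝ}
    (hr : IsIsolatingRadius a α r) : α ∈ spectrum ℂ a ↔ rieszProjection a α ≠ 0 :=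
  ⟨hr.rieszProjection_ne_zero, fun h => by
    by_contra hα
    exact h (hr.rieszProjection_eq_zero hα)⟩

/-- Riesz projections at distinct points are orthogonal: this is the lower growth bound for
`C_{a,a}`, which annihilates `1`. -/
theorem IsIsolatingRadius.rieszProjection_mul_eq_zero {a : A} {α β : ℂ} {r s : ℝ}
    (hr : IsIsolatingRadius a α r) (hs : IsIsolatingRadius a β s) (hne : α ≠ β) :
    rieszProjection a α * rieszProjection a β = 0 := by
  by_contra h
  have := hr.isSpectralPiece.norm_sub_le hs.isSpectralPiece le_rfl le_rfl h
  rw [varrho_self, add_zero, add_zero, norm_le_zero_iff, sub_eq_zero] at this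
  exact hne this

theorem ClustersOnlyAtZero.finite_spectrum {a : A} (ha : ClustersOnlyAtZero (nonzeroSpectrum a))
    {ε : ℝ} (hε : 0 < ε) : {z | z ∈ spectrum ℂ a ∧ ε ≤ ‖z‖}.Finite := by
  by_contra hinf
  have hK : IsCompact {z | z ∈ spectrum ℂ a ∧ ε ≤ ‖z‖} :=
    (spectrum.isCompact a).inter_right (isClosed_le continuous_const continuous_norm)
  obtain ⟨z, hz, hacc⟩ := Set.Infinite.exists_accPt_of_subset_isCompact hinf hK subset_rfl
  have h0 : z = 0 := ha z (hacc.mono (principal_mono.2 fun w hw =>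
    ⟨hw.1, fun hw0 => by
      have := hw.2
      rw [Set.mem_singleton_iff.1 hw0, norm_zero] at this
      linarith⟩))
  have := hz.2
  rw [h0, norm_zero] at this
  linarith

/-- For every `ε > 0`, the identity is the sum of the finitely many Riesz projections at the
spectral values of modulus at least `ε` and an idempotent on which `a` has spectral radius at most
`ε`. -/
theorem ClustersOnlyAtZero.exists_decomposition {a : A}
    (ha : ClustersOnlyAtZero (nonzeroSpectrum a)) {ε : ℝ} (hε : 0 < ε) :
    ∃ S : Finset ℂ, (∀ z, z ∈ S ↔ z ∈ spectrum ℂ a ∧ ε ≤ ‖z‖) ∧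
      IsIdempotentElem (1 - ∑ z ∈ S, rieszProjection a z) ∧
      IsSpectralPiece a (1 - ∑ z ∈ S, rieszProjection a z) 0 ε := by
  have hfin := ha.finite_spectrum hε
  have hmem : ∀ z, z ∈ hfin.toFinset ↔ z ∈ spectrum ℂ a ∧ ε ≤ ‖z‖ := fun z => by simp
  have hne : ∀ z : ℂ, ε ≤ ‖z‖ → z ≠ 0 := fun z hz h0 => by
    rw [h0, norm_zero] at hz
    linarith
  refine ⟨hfin.toFinset, hmem, ?_⟩
  set S := hfin.toFinset
  set e : A := 1 - ∑ z ∈ S, rieszProjection a z with he_def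
  have hiso : ∀ z, ε ≤ ‖z‖ → ∃ r, IsIsolatingRadius a z r := fun z hz =>
    ha.exists_isIsolatingRadius (hne z hz)
  have hPe : ∀ z ∈ S, rieszProjection a z * e = 0 := by
    intro z hz
    obtain ⟨r, hr⟩ := hiso z ((hmem z).1 hz).2
    rw [he_def, mul_sub, mul_one, Finset.mul_sum, Finset.sum_eq_single_of_mem z hz,
      hr.isIdempotentElem_rieszProjection.eq, sub_self]
    intro w hw hwz
    obtain ⟨s, hs⟩ := hiso w ((hmem w).1 hw).2
    exact hr.rieszProjection_mul_eq_zero hs hwz.symm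
  have he : IsIdempotentElem e := by
    have : (∑ z ∈ S, rieszProjection a z) * e = 0 := by
      rw [Finset.sum_mul]
      exact Finset.sum_eq_zero hPe
    rw [IsIdempotentElem]
    nth_rw 1 [he_def]
    rw [sub_mul, one_mul, this, sub_zero]
  have hcomm : ∀ x, Commute x a → Commute x e := fun x hx =>
    (Commute.one_right x).sub_right (Commute.sum_right _ _ _ fun z hz => by
      obtain ⟨r, hr⟩ := hiso z ((hmem z).1 hz).2
      exact hr.commute_rieszProjection hx)
  have hae : Commute a e := hcomm a (Commute.refl a)
  refine ⟨he, hae, fun r hr => ?_⟩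
  obtain ⟨K, hK⟩ := exists_norm_pow_le (x := a * e) hε.le hr fun z hz => by
    by_contra! hlt
    obtain ⟨s, hs⟩ := hiso z hlt.le
    obtain ⟨c, hc, hac⟩ := hs.exists_sub_mul_eq_one_sub
    refine notMem_spectrum_mul_of_sub_mul_eq (hne z hlt.le) he hae (hc a (Commute.refl a))
      (hc e hae.symm) hac ?_ hz
    by_cases hzS : z ∈ S
    · exact hPe z hzS
    · rw [hs.rieszProjection_eq_zero fun hza => hzS ((hmem z).2 ⟨hza, hlt.le⟩), zero_mul]
  refine ⟨K * ‖e‖, fun n => ?_⟩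
  have h1 : (a - algebraMap ℂ A 0) ^ n * e = (a * e) ^ n * e := by
    rw [map_zero, sub_zero, hae.mul_pow, mul_assoc, ← pow_succ, he.pow_succ_eq]
  rw [h1]
  calc _ ≤ _ := norm_mul_le _ _
    _ ≤ K * r ^ n * ‖e‖ := by gcongr; exact hK n
    _ = _ := by ring

/-! ### The case `ϱ(a,b) = 0` -/

/-- If `ϱ(a,b) = 0`, the Riesz projections `p` of `a` and `q` of `b` at a common non-accumulation
point agree: `p (b - α)ⁿ` and `(a - α)ⁿ q` decay superexponentially, which forces `p (1 - q) = 0`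
and `(1 - p) q = 0`. -/
theorem IsIsolatingRadius.rieszProjection_eq_of_varrho_eq_zero {a b : A} {α : ℂ} {r s : ℝ}
    (hr : IsIsolatingRadius a α r) (hs : IsIsolatingRadius b α s) (h0 : varrho a b = 0) :
    rieszProjection a α = rieszProjection b α := by
  obtain ⟨c, hc, hac⟩ := hr.exists_sub_mul_eq_one_sub
  obtain ⟨d, hd, hbd⟩ := hs.exists_sub_mul_eq_one_sub
  have h1 : rieszProjection a α * (1 - rieszProjection b α) = 0 :=
    mul_eq_zero_of_norm_mul_pow_le hs.isIdempotentElem_rieszProjection.one_sub hbd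
      (hd _ ((Commute.refl b).sub_left (Algebra.commutes α b)))
      fun t ht => hr.isSpectralPiece.exists_norm_mul_sub_pow_le h0 ht
  have h2 : (1 - rieszProjection a α) * rieszProjection b α = 0 :=
    mul_eq_zero_of_norm_pow_mul_le hr.isIdempotentElem_rieszProjection.one_sub hac
      (hc _ ((Commute.refl a).sub_left (Algebra.commutes α a)))
      fun t ht => hs.isSpectralPiece.exists_norm_sub_pow_mul_le h0 ht
  rw [mul_sub, mul_one, sub_eq_zero] at h1
  rw [sub_mul, one_mul, sub_eq_zero] at h2
  exact h1.trans h2.symm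

theorem spectrum_eq_of_varrho_eq_zero {a b : A} (ha : ClustersOnlyAtZero (nonzeroSpectrum a))
    (hb : ClustersOnlyAtZero (nonzeroSpectrum b)) (h0 : varrho a b = 0) :
    spectrum ℂ a = spectrum ℂ b := by
  have key : ∀ z r s, IsIsolatingRadius a z r → IsIsolatingRadius b z s →
      (z ∈ spectrum ℂ a ↔ z ∈ spectrum ℂ b) := fun z r s hr hs => by
    rw [hr.mem_spectrum_iff, hs.mem_spectrum_iff, hr.rieszProjection_eq_of_varrho_eq_zero hs h0]
  have hnz : ∀ z, z ≠ 0 → (z ∈ spectrum ℂ a ↔ z ∈ spectrum ℂ b) := fun z hz => by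
    obtain ⟨r, hr⟩ := ha.exists_isIsolatingRadius hz
    obtain ⟨s, hs⟩ := hb.exists_isIsolatingRadius hz
    exact key z r s hr hs
  have hσ : nonzeroSpectrum a = nonzeroSpectrum b := by
    ext z
    exact and_congr_left fun hz => hnz z hz
  have hacc : ∀ x : A, AccPt 0 (𝓟 (nonzeroSpectrum x)) → 0 ∈ spectrum ℂ x := fun x hx =>
    (spectrum.isClosed x).closure_subset
      (mem_closure_iff_clusterPt.2 (hx.mono (principal_mono.2 Set.sdiff_subset)).clusterPt)
  ext z
  by_cases hz : z = 0
  · subst hz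
    by_cases h : AccPt 0 (𝓟 (nonzeroSpectrum a))
    · exact iff_of_true (hacc a h) (hacc b (hσ ▸ h))
    · obtain ⟨r, hr⟩ := exists_isIsolatingRadius h
      obtain ⟨s, hs⟩ := exists_isIsolatingRadius (hσ ▸ h : ¬ AccPt 0 (𝓟 (nonzeroSpectrum b)))
      exact key 0 r s hr hs
  · exact hnz z hz

theorem varrho_eq_zero_of_rieszProjection_eq {a b : A}
    (ha : ClustersOnlyAtZero (nonzeroSpectrum a)) (hb : ClustersOnlyAtZero (nonzeroSpectrum b))
    (hσ : spectrum ℂ a = spectrum ℂ b)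
    (hp : ∀ l ∈ nonzeroSpectrum a, rieszProjection a l = rieszProjection b l) :
    varrho a b = 0 := by
  refine le_antisymm (le_of_forall_pos_le_add fun ρ hρ => ?_) (varrho_nonneg a b)
  rw [zero_add]
  have hε : 0 < ρ / 4 := by positivity
  obtain ⟨S, hS, he, hSa⟩ := ha.exists_decomposition hε
  obtain ⟨T, hT, -, hTb⟩ := hb.exists_decomposition hε
  have hST : T = S := by
    ext z
    rw [hS, hT, hσ]
  subst hST
  have hne : ∀ z ∈ T, z ≠ 0 := fun z hz h0 => by
    have := ((hS z).1 hz).2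
    rw [h0, norm_zero] at this
    linarith
  have hpT : ∀ z ∈ T, rieszProjection a z = rieszProjection b z := fun z hz =>
    hp z ⟨((hS z).1 hz).1, hne z hz⟩
  rw [← Finset.sum_congr rfl hpT] at hTb
  have h1 : GrowsBelow a b ρ
      (∑ z ∈ T, rieszProjection a z + (1 - ∑ z ∈ T, rieszProjection a z)) := by
    refine (GrowsBelow.sum hρ T fun z hz => ?_).add ?_
    · obtain ⟨r, hr⟩ := ha.exists_isIsolatingRadius (hne z hz)
      obtain ⟨s, hs⟩ := hb.exists_isIsolatingRadius (hne z hz)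
      have h2 := hr.isSpectralPiece.growsBelow hs.isSpectralPiece le_rfl le_rfl
        (ρ := ρ) (by simpa using hρ)
      rwa [← hpT z hz, hr.isIdempotentElem_rieszProjection.eq] at h2
    · have h2 := hSa.growsBelow hTb hε.le hε.le (ρ := ρ) (by simp; linarith)
      rwa [he.eq] at h2
  rw [add_sub_cancel] at h1
  exact h1.varrho_lt.le

/-! ### The value of `ϱ(a,b)` -/

theorem le_varrho_of_mem_distanceSet {a b : A} (ha : ClustersOnlyAtZero (nonzeroSpectrum a))
    (hb : ClustersOnlyAtZero (nonzeroSpectrum b)) {d : ℝ} (hd : d ∈ distanceSet a b) :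
    d ≤ varrho a b := by
  obtain ⟨l, hl, m, hm, hlm, rfl⟩ := hd
  obtain ⟨r, hr⟩ := ha.exists_isIsolatingRadius hl.2
  obtain ⟨s, hs⟩ := hb.exists_isIsolatingRadius hm.2
  simpa using hr.isSpectralPiece.norm_sub_le hs.isSpectralPiece le_rfl le_rfl hlm

theorem exists_norm_gap {a : A} {ρ : ℝ} (h : ∀ z ∈ spectrum ℂ a, ‖z‖ ≠ ρ) :
    ∃ δ > 0, ∀ z ∈ spectrum ℂ a, δ ≤ |‖z‖ - ρ| := by
  have hcl : IsClosed (norm '' spectrum ℂ a) :=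
    ((spectrum.isCompact a).image continuous_norm).isClosed
  have hρ : ρ ∈ (norm '' spectrum ℂ a)ᶜ := by
    rintro ⟨z, hz, hzρ⟩
    exact h z hz hzρ
  obtain ⟨δ, hδ, hball⟩ := Metric.isOpen_iff.1 hcl.isOpen_compl ρ hρ
  refine ⟨δ, hδ, fun z hz => ?_⟩
  by_contra! hlt
  exact hball (Metric.mem_ball.2 hlt) ⟨z, hz, rfl⟩

/-- If a positive `ϱ(a,b)` is not the modulus of a spectral value of `a` or `b`, it is attained as
a distance: otherwise all terms of the product of two decompositions of the identity would grow
at a rate strictly below it. -/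
theorem varrho_mem_distanceSet {a b : A} (ha : ClustersOnlyAtZero (nonzeroSpectrum a))
    (hb : ClustersOnlyAtZero (nonzeroSpectrum b)) (hρ : 0 < varrho a b)
    (hρa : ∀ z ∈ spectrum ℂ a, ‖z‖ ≠ varrho a b) (hρb : ∀ z ∈ spectrum ℂ b, ‖z‖ ≠ varrho a b) :
    varrho a b ∈ distanceSet a b := by
  by_contra hW
  obtain ⟨δ, hδ, hδa⟩ := exists_norm_gap hρa
  obtain ⟨δ', hδ', hδb⟩ := exists_norm_gap hρb
  -- Mixed terms force `‖z‖ ≤ ϱ + ε`, which the gap improves to `‖z‖ + ε < ϱ`.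
  obtain ⟨ε, hε, hε1, hε2, hε3⟩ : ∃ ε > 0, ε < δ ∧ ε < δ' ∧ ε + ε < varrho a b :=
    ⟨min (min δ δ') (varrho a b) / 3, by positivity, by
      have := min_le_left (min δ δ') (varrho a b)
      have := min_le_left δ δ'
      linarith, by
      have := min_le_left (min δ δ') (varrho a b)
      have := min_le_right δ δ'
      linarith, by
      have := min_le_right (min δ δ') (varrho a b)
      linarith⟩
  obtain ⟨S, hS, -, hSa⟩ := ha.exists_decomposition hε
  obtain ⟨T, hT, -, hTb⟩ := hb.exists_decomposition hε
  have hne : ∀ z : ℂ, ε ≤ ‖z‖ → z ≠ 0 := fun z hz h0 => by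
    rw [h0, norm_zero] at hz
    linarith
  have hpa : ∀ z ∈ S, IsSpectralPiece a (rieszProjection a z) z 0 := fun z hz =>
    (ha.exists_isIsolatingRadius (hne z ((hS z).1 hz).2)).elim fun _ hr => hr.isSpectralPiece
  have hpb : ∀ z ∈ T, IsSpectralPiece b (rieszProjection b z) z 0 := fun z hz =>
    (hb.exists_isIsolatingRadius (hne z ((hT z).1 hz).2)).elim fun _ hr => hr.isSpectralPiece
  have hgap : ∀ {γ t : ℝ}, ε < γ → t ≤ varrho a b + ε → γ ≤ |t - varrho a b| →
      t + ε < varrho a b := by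
    intro γ t hγ ht hle
    rcases le_abs.1 hle with h | h <;> linarith
  have h1 : GrowsBelow a b (varrho a b)
      ((∑ z ∈ S, rieszProjection a z + (1 - ∑ z ∈ S, rieszProjection a z)) *
        (∑ w ∈ T, rieszProjection b w + (1 - ∑ w ∈ T, rieszProjection b w))) := by
    rw [add_mul, Finset.sum_mul, mul_add (1 - _), Finset.mul_sum]
    refine GrowsBelow.add (GrowsBelow.sum hρ S fun z hz => ?_)
      (GrowsBelow.add (GrowsBelow.sum hρ T fun w hw => ?_) ?_)
    · rw [mul_add, Finset.mul_sum]
      refine GrowsBelow.add (GrowsBelow.sum hρ T fun w hw => ?_) ?_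
      · by_cases h0 : rieszProjection a z * rieszProjection b w = 0
        · exact h0 ▸ GrowsBelow.zero a b hρ
        · have hd : ‖z - w‖ ∈ distanceSet a b :=
            ⟨z, ⟨((hS z).1 hz).1, hne z ((hS z).1 hz).2⟩, w,
              ⟨((hT w).1 hw).1, hne w ((hT w).1 hw).2⟩, h0, rfl⟩
          refine (hpa z hz).growsBelow (hpb w hw) le_rfl le_rfl ?_
          rw [add_zero, add_zero]
          exact lt_of_le_of_ne (le_varrho_of_mem_distanceSet ha hb hd) fun h => hW (h ▸ hd)
      · by_cases h0 : rieszProjection a z * (1 - ∑ w ∈ T, rieszProjection b w) = 0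
        · exact h0 ▸ GrowsBelow.zero a b hρ
        · have hle := (hpa z hz).norm_sub_le hTb le_rfl hε.le h0
          refine (hpa z hz).growsBelow hTb le_rfl hε.le ?_
          rw [sub_zero, add_zero] at hle ⊢
          exact hgap hε1 hle (hδa z ((hS z).1 hz).1)
    · by_cases h0 : (1 - ∑ z ∈ S, rieszProjection a z) * rieszProjection b w = 0
      · exact h0 ▸ GrowsBelow.zero a b hρ
      · have hle := hSa.norm_sub_le (hpb w hw) hε.le le_rfl h0
        refine hSa.growsBelow (hpb w hw) hε.le le_rfl ?_
        rw [zero_sub, norm_neg, add_zero] at hle ⊢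
        exact hgap hε2 hle (hδb w ((hT w).1 hw).1)
    · refine hSa.growsBelow hTb hε.le hε.le ?_
      rwa [sub_zero, norm_zero, zero_add]
  rw [add_sub_cancel, add_sub_cancel, one_mul] at h1
  exact lt_irrefl _ h1.varrho_lt

end RieszSpectral

theorem theorem2p4 {A : Type*} [NormedRing A] [NormedAlgebra ℂ A] [CompleteSpace A] (a b : A)
    (ha : RieszSpectral.ClustersOnlyAtZero (RieszSpectral.nonzeroSpectrum a))
    (hb : RieszSpectral.ClustersOnlyAtZero (RieszSpectral.nonzeroSpectrum b)) :
    (RieszSpectral.varrho a b = sSup (RieszSpectral.distanceSet a b) ∨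
      (∃ l ∈ RieszSpectral.nonzeroSpectrum a, RieszSpectral.varrho a b = ‖l‖) ∨
      (∃ m ∈ RieszSpectral.nonzeroSpectrum b, RieszSpectral.varrho a b = ‖m‖)) ∧
    (RieszSpectral.varrho a b = 0 ↔
      spectrum ℂ a = spectrum ℂ b ∧
        ∀ l ∈ RieszSpectral.nonzeroSpectrum a,
          RieszSpectral.rieszProjection a l = RieszSpectral.rieszProjection b l) := by
  have hle : ∀ d ∈ RieszSpectral.distanceSet a b, d ≤ RieszSpectral.varrho a b := fun d hd =>
    RieszSpectral.le_varrho_of_mem_distanceSet ha hb hd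
  refine ⟨?_, fun h0 => ⟨RieszSpectral.spectrum_eq_of_varrho_eq_zero ha hb h0, fun l hl => ?_⟩,
    fun h => RieszSpectral.varrho_eq_zero_of_rieszProjection_eq ha hb h.1 h.2⟩
  · rcases (RieszSpectral.varrho_nonneg a b).eq_or_lt with h0 | hpos
    · -- All distances vanish; the distance set may be empty, where the supremum is `0`.
      left
      rw [← h0] at hle ⊢
      refine le_antisymm (Real.sSup_nonneg ?_) (Real.sSup_nonpos hle)
      rintro d ⟨l, -, m, -, -, rfl⟩
      exact norm_nonneg _
    · by_contra! hcon
      obtain ⟨hsup, hna, hnb⟩ := hcon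
      refine hsup (IsGreatest.csSup_eq ⟨RieszSpectral.varrho_mem_distanceSet ha hb hpos ?_ ?_,
        hle⟩).symm
      · intro z hz hzρ
        exact hna z ⟨hz, fun h => by simp_all⟩ hzρ.symm
      · intro z hz hzρ
        exact hnb z ⟨hz, fun h => by simp_all⟩ hzρ.symm
  · obtain ⟨r, hr⟩ := ha.exists_isIsolatingRadius hl.2
    obtain ⟨s, hs⟩ := hb.exists_isIsolatingRadius hl.2
    exact hr.rieszProjection_eq_of_varrho_eq_zero hs h0
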